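/- Let $\mathbb{F}$ be a field, $G$ a group, and $\mathcal{V}$ an $\mathbb{F}$-vector space with a basis $\beta=\{u_i\mid i\in\mathbb{N}\}$ ordered as $\mathbb{N}$ (so $u_i\le u_j$ if and only if $i\le j$). Let $e_{uv}$ ($u,v\in\beta$) be the linear map with $e_{uv}(v)=u$ and $e_{uv}(w)=0$ for $w\in\beta\setminus\{v\}$. Let $\mathrm{UT}_{\beta}\mathcal{V}$ be the algebra of all $t\in\mathrm{End}_{\mathbb{F}}\mathcal{V}$ with $t(v)\in\mathrm{Span}\{w\in\beta\mid w\le v\}$ for every $v\in\beta$, and let $\mathrm{UT}_{\to\beta}\mathcal{V}=\mathrm{Span}\{e_{uv}\mid u\le v\in\beta\}$. A $G$-grading on an algebra $\mathcal{A}$ is a decomposition $\mathcal{A}=\bigoplus_{g\in G}\mathcal{A}_g$ into subspaces with $\mathcal{A}_g\mathcal{A}_h\subseteq\mathcal{A}_{gh}$ for all $g,h\in G$; its support is $\{g\in G\mid \mathcal{A}_g\ne 0\}$. Two $G$-gradings on $\mathcal{A}$ with components $\mathcal{A}_g$ and $\mathcal{A}'_g$ are isomorphic if there is an algebra automorphism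 $f$ of $\mathcal{A}$ with $f(\mathcal{A}_g)\subseteq\mathcal{A}'_g$ for all $g\in G$. For $\mathcal{A}=\mathrm{UT}_{\to\beta}\mathcal{V}$ or $\mathcal{A}=\mathrm{UT}_{\beta}\mathcal{V}$, a $G$-grading on $\mathcal{A}$ is elementary if there is a map $\gamma\colon\beta\to G$ such that $e_{uv}\in\mathcal{A}_{\gamma(u)^{-1}\gamma(v)}$ for all $u\le v$ in $\beta$. Then every $G$-grading on $\mathcal{A}$, where $\mathcal{A}=\mathrm{UT}_{\to\beta}\mathcal{V}$ or $\mathcal{A}=\mathrm{UT}_{\beta}\mathcal{V}$, is isomorphic to an elementary $G$-grading on $\mathcal{A}$. Moreover, every $G$-grading on $\mathrm{UT}_{\beta}\mathcal{V}$ has finite support. -/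

import Mathlib

/-! Group gradings on algebras of infinite upper triangular matrices. -/

/-! ### Group gradings on (not necessarily unital) algebras -/

section Gradings

variable {F A B G : Type*} [Field F]
  [NonUnitalRing A] [Module F A] [NonUnitalRing B] [Module F B] [Group G]

open Classical in
/-- `𝒜` is a `G`-grading of `A`: the space `A` is the direct sum of the subspaces `𝒜 g`, and
`𝒜 g * 𝒜 h ⊆ 𝒜 (g * h)`. -/
structure IsGroupGrading (𝒜 : G → Submodule F A) : Prop where
  isInternal : DirectSum.IsInternal 𝒜
  mul_mem : ∀ (g h : G) (x y : A), x ∈ 𝒜 g → y ∈ 𝒜 h → x * y ∈ 𝒜 (g * h)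

/-- The support of a grading: the degrees whose homogeneous component is nonzero. -/
def gradingSupport (𝒜 : G → Submodule F A) : Set G :=
  {g | 𝒜 g ≠ ⊥}

/-- Graded algebras are isomorphic if there is an isomorphism of algebras mapping each homogeneous
component into the homogeneous component of the same degree. -/
def GradingIso (𝒜 : G → Submodule F A) (ℬ : G → Submodule F B) : Prop :=
  ∃ f : A →ₙₐ[F] B, Function.Bijective f ∧ ∀ (g : G) (x : A), x ∈ 𝒜 g → f x ∈ ℬ g

end Gradings

/-! ### Triangular algebras -/

section Triangular

variable {F V ι G : Type*} [Field F] [AddCommGroup V] [Module F V] [LinearOrder ι] [Group G]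

/-- The matrix unit `e_{uv}`, mapping the basis vector `b v` to `b u` and all other basis vectors
to `0`. -/
noncomputable def matrixUnit (b : Module.Basis ι F V) (u v : ι) : Module.End F V :=
  (b.coord v).smulRight (b u)

theorem matrixUnit_apply_basis (b : Module.Basis ι F V) (u v w : ι) :
    matrixUnit b u v (b w) = if w = v then b u else 0 := by
  simp [matrixUnit, Finsupp.single_apply]

theorem matrixUnit_mul (b : Module.Basis ι F V) (u v w z : ι) :
    matrixUnit b u v * matrixUnit b w z = if w = v then matrixUnit b u z else 0 := by
  refine b.ext fun k => ?_
  by_cases h1 : w = v <;> by_cases h2 : k = z <;>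
    simp [Module.End.mul_apply, matrixUnit_apply_basis, h1, h2]

/-- `V(v)`, the span of the basis vectors whose index is at most `v`. -/
def lowerSpan (b : Module.Basis ι F V) (v : ι) : Submodule F V :=
  Submodule.span F (b '' Set.Iic v)

theorem lowerSpan_mono (b : Module.Basis ι F V) {u v : ι} (h : u ≤ v) :
    lowerSpan b u ≤ lowerSpan b v :=
  Submodule.span_mono (Set.image_mono (Set.Iic_subset_Iic.2 h))

theorem basis_mem_lowerSpan (b : Module.Basis ι F V) {u v : ι} (h : u ≤ v) :
    b u ∈ lowerSpan b v :=
  Submodule.subset_span ⟨u, h, rfl⟩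

theorem map_mem_lowerSpan (b : Module.Basis ι F V) {t : Module.End F V}
    (ht : ∀ v, t (b v) ∈ lowerSpan b v) (v : ι) {x : V} (hx : x ∈ lowerSpan b v) :
    t x ∈ lowerSpan b v := by
  have h : lowerSpan b v ≤ (lowerSpan b v).comap t := by
    refine Submodule.span_le.2 ?_
    rintro _ ⟨u, hu, rfl⟩
    exact lowerSpan_mono b hu (ht u)
  exact h hx

/-- The full upper triangular algebra of the ordered basis `b`: all endomorphisms `t` of `V` with
`t (b v) ∈ V(v)` for every `v`. -/
def fullUT (b : Module.Basis ι F V) : Subalgebra F (Module.End F V) where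
  carrier := {t | ∀ v, t (b v) ∈ lowerSpan b v}
  mul_mem' := fun hs ht v => map_mem_lowerSpan b hs v (ht v)
  add_mem' := fun hs ht v => add_mem (hs v) (ht v)
  algebraMap_mem' := fun c v => by
    simpa [Module.algebraMap_end_apply] using
      (lowerSpan b v).smul_mem c (basis_mem_lowerSpan b le_rfl)

/-- The set of upper triangular matrix units. -/
def matrixUnits (b : Module.Basis ι F V) : Set (Module.End F V) :=
  {t | ∃ u v : ι, u ≤ v ∧ t = matrixUnit b u v}

/-- The direct limit algebra: the linear span of the matrix units `e_{uv}` with `u ≤ v`. It is in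
general not unital. -/
def limUT (b : Module.Basis ι F V) : NonUnitalSubalgebra F (Module.End F V) where
  toAddSubmonoid := (Submodule.span F (matrixUnits b)).toAddSubmonoid
  smul_mem' := fun c _ hx => (Submodule.span F (matrixUnits b)).smul_mem c hx
  mul_mem' := by
    intro s t hs ht
    change s ∈ Submodule.span F (matrixUnits b) at hs
    change t ∈ Submodule.span F (matrixUnits b) at ht
    change s * t ∈ Submodule.span F (matrixUnits b)
    have h := Submodule.mul_mem_mul hs ht
    rw [Submodule.span_mul_span] at h
    refine (Submodule.span_le.2 ?_ : _ ≤ Submodule.span F (matrixUnits b)) h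
    rintro _ ⟨_, ⟨u, v, huv, rfl⟩, _, ⟨w, z, hwz, rfl⟩, rfl⟩
    change matrixUnit b u v * matrixUnit b w z ∈ Submodule.span F (matrixUnits b)
    rw [matrixUnit_mul]
    split_ifs with h
    · exact Submodule.subset_span ⟨u, z, huv.trans (h ▸ hwz), rfl⟩
    · exact zero_mem _

/-- A grading `𝒜` of an algebra `A` of endomorphisms of `V` containing all `e_{uv}` with `u ≤ v` is
elementary if for some map `γ` to the group every matrix unit `e_{uv}` in `A` is homogeneous of
degree `γ(u)⁻¹ γ(v)`. -/
def IsElementaryGrading (b : Module.Basis ι F V) {A : NonUnitalSubalgebra F (Module.End F V)}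
    (𝒜 : G → Submodule F A) : Prop :=
  ∃ γ : ι → G, ∀ (u v : ι), u ≤ v → ∀ h : matrixUnit b u v ∈ A,
    (⟨matrixUnit b u v, h⟩ : A) ∈ 𝒜 ((γ u)⁻¹ * γ v)

/-- The hypothesis `matrixUnit b u v ∈ A` in the preceding definition is automatic. -/
theorem matrixUnit_mem_limUT (b : Module.Basis ι F V) {u v : ι} (h : u ≤ v) :
    matrixUnit b u v ∈ limUT b :=
  Submodule.subset_span ⟨u, v, h, rfl⟩

theorem limUT_le_fullUT (b : Module.Basis ι F V) :
    limUT b ≤ (fullUT b).toNonUnitalSubalgebra := by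
  intro t ht
  have h : Submodule.span F (matrixUnits b) ≤ Subalgebra.toSubmodule (fullUT b) := by
    refine Submodule.span_le.2 ?_
    rintro _ ⟨u, v, huv, rfl⟩ w
    rw [matrixUnit_apply_basis]
    split_ifs with hw
    · exact basis_mem_lowerSpan b (hw ▸ huv)
    · exact zero_mem _
  exact h ht

end Triangular

/-! Let R be the ideal of matrices supported in the first row (`rowsLT b A 1`). It is a faithful
right module over the algebra A, and once R is known to be graded, a is homogeneous of degree k as
soon as right multiplication by a shifts degrees in R by k (`mem_of_forall_mul_mem`). So it is
enough to find good homogeneous coordinates on R.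

The crux is that the ideals `rowsLT b A j` are graded (`proj_mem_rowsLT`). This goes by induction on
j and rests on `entry_proj_unitOf_eq_zero`, a convolution argument with the (j, j) entries of
homogeneous components. The left annihilators `colsGE b A j` are then graded too, so R has
homogeneous elements r_i, of degrees γ i, with leading entry 1 in position i. The endomorphism e
with rows r_i is unitriangular, hence invertible. Comparing leading entries shows that a homogeneous
row involves only frame elements of its own degree (`degree_eq`). Since e⁻¹ e_{ij} e sends a row w
to c_i(w) r_j, where c_i(w) is the i-th frame coordinate, it has degree (γ i)⁻¹ γ j, and conjugation
by e makes the grading elementary.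

In the full algebra any frame will do. The row whose frame coordinates are all 1 has finitely many
homogeneous components, so γ takes finitely many values and the support is finite. In the direct
limit algebra conjugation must preserve finiteness of matrices, which needs e⁻¹ to have finite rows;
frame elements of minimal length ensure this. -/

/-! ### Homogeneous components -/

section Components

variable {F A G : Type*} [Field F] [NonUnitalRing A] [Module F A] [Group G]

namespace IsGroupGrading

variable {𝒜 : G → Submodule F A}

open Classical in
/-- The projection onto the homogeneous component of degree `g`. -/
noncomputable def proj (h : IsGroupGrading 𝒜) (g : G) : A →ₗ[F] A :=
  (𝒜 g).subtype ∘ₗ DirectSum.component F G (fun i => 𝒜 i) g ∘ₗ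
    (LinearEquiv.ofBijective (DirectSum.coeLinearMap 𝒜) h.isInternal).symm.toLinearMap

theorem proj_mem (h : IsGroupGrading 𝒜) (g : G) (x : A) : h.proj g x ∈ 𝒜 g :=
  Subtype.coe_prop _

open Classical in
theorem ofBijective_symm_of_mem (h : IsGroupGrading 𝒜) {g : G} {x : A} (hx : x ∈ 𝒜 g) :
    (LinearEquiv.ofBijective (DirectSum.coeLinearMap 𝒜) h.isInternal).symm x =
      DirectSum.lof F G (fun i => 𝒜 i) g ⟨x, hx⟩ := by
  rw [LinearEquiv.symm_apply_eq]
  exact (DirectSum.coeLinearMap_lof 𝒜 g (⟨x, hx⟩ : 𝒜 g)).symm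

theorem proj_of_mem (h : IsGroupGrading 𝒜) {g : G} {x : A} (hx : x ∈ 𝒜 g) : h.proj g x = x := by
  classical
  simp only [proj, LinearMap.comp_apply, LinearEquiv.coe_coe, h.ofBijective_symm_of_mem hx]
  rw [DirectSum.component.lof_self]
  rfl

theorem proj_of_mem_ne (h : IsGroupGrading 𝒜) {g k : G} {x : A} (hx : x ∈ 𝒜 g) (hk : k ≠ g) :
    h.proj k x = 0 := by
  classical
  simp only [proj, LinearMap.comp_apply, LinearEquiv.coe_coe, h.ofBijective_symm_of_mem hx]
  rw [DirectSum.component.of, dif_neg hk.symm]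
  simp

theorem induction (h : IsGroupGrading 𝒜) {p : A → Prop} (mem : ∀ g, ∀ x ∈ 𝒜 g, p x)
    (zero : p 0) (add : ∀ x y, p x → p y → p (x + y)) (x : A) : p x := by
  classical
  have hx : x ∈ ⨆ g, 𝒜 g := by
    rw [h.isInternal.submodule_iSup_eq_top]; trivial
  exact Submodule.iSup_induction 𝒜 (motive := p) hx mem zero add

theorem exists_sum_proj (h : IsGroupGrading 𝒜) (x : A) :
    ∃ s : Finset G, x = ∑ g ∈ s, h.proj g x := by
  classical
  -- Vanishing outside s lets both sums be enlarged to the union in the additive step.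
  suffices H : ∃ s : Finset G, (∀ g ∉ s, h.proj g x = 0) ∧ x = ∑ g ∈ s, h.proj g x from
    H.imp fun _ hs => hs.2
  induction x using h.induction with
  | mem g x hx =>
    refine ⟨{g}, fun k hk => h.proj_of_mem_ne hx (by simpa using hk), ?_⟩
    simp [h.proj_of_mem hx]
  | zero => exact ⟨∅, by simp⟩
  | add x y hx hy =>
    obtain ⟨s, hs, hxs⟩ := hx
    obtain ⟨t, ht, hyt⟩ := hy
    refine ⟨s ∪ t, fun k hk => ?_, ?_⟩
    · rw [Finset.mem_union, not_or] at hk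
      rw [map_add, hs k hk.1, ht k hk.2, add_zero]
    · simp only [map_add, Finset.sum_add_distrib]
      rw [← Finset.sum_subset Finset.subset_union_left fun g _ hg => hs g hg,
        ← Finset.sum_subset Finset.subset_union_right fun g _ hg => ht g hg, ← hxs, ← hyt]

theorem mem_of_forall_proj_eq_zero (h : IsGroupGrading 𝒜) {g : G} {x : A}
    (hx : ∀ k, k ≠ g → h.proj k x = 0) : x ∈ 𝒜 g := by
  obtain ⟨s, hs⟩ := h.exists_sum_proj x
  rw [hs]
  refine sum_mem fun k _ => ?_
  by_cases hk : k = g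
  · exact hk ▸ h.proj_mem k x
  · rw [hx k hk]; exact zero_mem _

theorem proj_mul_left (h : IsGroupGrading 𝒜) {k : G} {a : A} (ha : a ∈ 𝒜 k) (g : G) (x : A) :
    h.proj (k * g) (a * x) = a * h.proj g x := by
  induction x using h.induction with
  | mem l x hx =>
    have hax := h.mul_mem k l a x ha hx
    by_cases hg : g = l
    · rw [hg, h.proj_of_mem hax, h.proj_of_mem hx]
    · rw [h.proj_of_mem_ne hx hg, h.proj_of_mem_ne hax (by simpa using hg), mul_zero]
  | zero => simp
  | add x y hx hy => simp only [mul_add, map_add, hx, hy]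

theorem proj_mul_right (h : IsGroupGrading 𝒜) {k : G} {a : A} (ha : a ∈ 𝒜 k) (g : G) (x : A) :
    h.proj (g * k) (x * a) = h.proj g x * a := by
  induction x using h.induction with
  | mem l x hx =>
    have hax := h.mul_mem l k x a hx ha
    by_cases hg : g = l
    · rw [hg, h.proj_of_mem hax, h.proj_of_mem hx]
    · rw [h.proj_of_mem_ne hx hg, h.proj_of_mem_ne hax (by simpa using hg), zero_mul]
  | zero => simp
  | add x y hx hy => simp only [add_mul, map_add, hx, hy]

/-- The image of a grading under an isomorphism of algebras is a grading. -/
theorem map {B : Type*} [NonUnitalRing B] [Module F B] (h : IsGroupGrading 𝒜) (e : A ≃ₗ[F] B)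
    (he : ∀ x y, e (x * y) = e x * e y) :
    IsGroupGrading fun g => (𝒜 g).map (e : A →ₗ[F] B) where
  isInternal := by
    classical
    rw [DirectSum.isInternal_submodule_iff_iSupIndep_and_iSup_eq_top]
    have h1 := (DirectSum.isInternal_submodule_iff_iSupIndep_and_iSup_eq_top 𝒜).1 h.isInternal
    constructor
    · exact (iSupIndep_map_orderIso_iff (Submodule.orderIsoMapComap e)).2 h1.1
    · rw [← Submodule.map_iSup, h1.2, Submodule.map_top, LinearEquiv.range]
  mul_mem := by
    rintro g k _ _ ⟨x, hx, rfl⟩ ⟨y, hy, rfl⟩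
    exact ⟨x * y, h.mul_mem g k x y hx hy, he x y⟩

end IsGroupGrading

end Components

/-! ### Matrix entries -/

section Entries

variable {F V : Type*} [Field F] [AddCommGroup V] [Module F V]

/-- The entry in row `i` and column `k` of the matrix of an endomorphism. -/
noncomputable def entry {ι : Type*} (b : Module.Basis ι F V) (i k : ι) :
    Module.End F V →ₗ[F] F :=
  b.coord i ∘ₗ LinearMap.applyₗ (b k)

theorem entry_apply {ι : Type*} (b : Module.Basis ι F V) (i k : ι) (t : Module.End F V) :
    entry b i k t = b.coord i (t (b k)) := rfl

theorem ext_entry {ι : Type*} (b : Module.Basis ι F V) {s t : Module.End F V}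
    (h : ∀ i k, entry b i k s = entry b i k t) : s = t :=
  b.ext fun k => b.ext_elem fun i => h i k

theorem coord_eq_sum {ι : Type*} (b : Module.Basis ι F V) (f : V →ₗ[F] F) (x : V) :
    f x = (b.repr x).sum fun l c => c * f (b l) := by
  conv_lhs => rw [← b.linearCombination_repr x]
  simp [Finsupp.linearCombination_apply, Finsupp.sum, map_sum]

theorem apply_eq_single {ι : Type*} (b : Module.Basis ι F V) (f : V →ₗ[F] F) (x : V) (j : ι)
    (h : ∀ l, l ≠ j → f (b l) = 0 ∨ b.coord l x = 0) : f x = f (b j) * b.coord j x := by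
  rw [coord_eq_sum b f x, Finsupp.sum]
  rw [Finset.sum_eq_single j]
  · rw [mul_comm]; rfl
  · intro l _ hl
    rcases h l hl with h | h
    · rw [h, mul_zero]
    · rw [Module.Basis.coord_apply] at h
      rw [h, zero_mul]
  · intro hj
    rw [Finsupp.notMem_support_iff.1 hj, zero_mul]

theorem apply_eq_zero {ι : Type*} (b : Module.Basis ι F V) (f : V →ₗ[F] F) (x : V)
    (h : ∀ l, f (b l) = 0 ∨ b.coord l x = 0) : f x = 0 := by
  rw [coord_eq_sum b f x, Finsupp.sum]
  refine Finset.sum_eq_zero fun l _ => ?_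
  rcases h l with h | h
  · rw [h, mul_zero]
  · rw [Module.Basis.coord_apply] at h
    rw [h, zero_mul]

theorem entry_mul_eq_single {ι : Type*} (b : Module.Basis ι F V) {s t : Module.End F V}
    {i k : ι} (j : ι) (h : ∀ l, l ≠ j → entry b i l s = 0 ∨ entry b l k t = 0) :
    entry b i k (s * t) = entry b i j s * entry b j k t :=
  apply_eq_single b (b.coord i ∘ₗ s) (t (b k)) j h

theorem entry_mul_eq_zero {ι : Type*} (b : Module.Basis ι F V) {s t : Module.End F V}
    {i k : ι} (h : ∀ l, entry b i l s = 0 ∨ entry b l k t = 0) :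
    entry b i k (s * t) = 0 :=
  apply_eq_zero b (b.coord i ∘ₗ s) (t (b k)) h

theorem entry_matrixUnit {ι : Type*} [LinearOrder ι] (b : Module.Basis ι F V) (i k u v : ι) :
    entry b i k (matrixUnit b u v) = if i = u ∧ k = v then 1 else 0 := by
  rw [entry_apply, matrixUnit_apply_basis]
  by_cases hk : k = v <;> by_cases hi : i = u <;> simp [hk, hi]

theorem entry_matrixUnit_mul {ι : Type*} [LinearOrder ι] (b : Module.Basis ι F V) (i k u v : ι)
    (t : Module.End F V) :
    entry b i k (matrixUnit b u v * t) = if i = u then entry b v k t else 0 := by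
  rw [entry_mul_eq_single b v]
  · by_cases hi : i = u <;> simp [entry_matrixUnit, hi]
  · intro l hl
    left
    simp [entry_matrixUnit, hl]

theorem entry_mul_matrixUnit {ι : Type*} [LinearOrder ι] (b : Module.Basis ι F V) (i k u v : ι)
    (t : Module.End F V) :
    entry b i k (t * matrixUnit b u v) = if k = v then entry b i u t else 0 := by
  rw [entry_mul_eq_single b u]
  · by_cases hi : k = v <;> simp [entry_matrixUnit, hi]
  · intro l hl
    right
    simp [entry_matrixUnit, hl]

theorem mem_lowerSpan_iff {ι : Type*} [LinearOrder ι] (b : Module.Basis ι F V) {v : ι} {x : V} :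
    x ∈ lowerSpan b v ↔ ∀ i, v < i → b.coord i x = 0 := by
  rw [lowerSpan, Module.Basis.mem_span_image]
  constructor
  · intro h i hi
    by_contra hc
    exact absurd (h (Finsupp.mem_support_iff.2 hc)) (not_le.2 hi)
  · intro h i hi
    by_contra hc
    exact Finsupp.mem_support_iff.1 hi (h i (not_le.1 hc))

theorem mem_fullUT_iff {ι : Type*} [LinearOrder ι] (b : Module.Basis ι F V)
    {t : Module.End F V} : t ∈ fullUT b ↔ ∀ i k, k < i → entry b i k t = 0 := by
  change (∀ k, t (b k) ∈ lowerSpan b k) ↔ _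
  simp only [mem_lowerSpan_iff, entry_apply]
  exact forall_comm

/-- Over ℕ every column of an upper triangular matrix is finite, so finitely many nonzero columns
mean finitely many nonzero entries. -/
theorem mem_limUT_iff (b : Module.Basis ℕ F V) {t : Module.End F V} :
    t ∈ limUT b ↔ t ∈ fullUT b ∧ ∃ N, ∀ k, N ≤ k → t (b k) = 0 := by
  constructor
  · intro h
    refine ⟨limUT_le_fullUT b h, ?_⟩
    change t ∈ Submodule.span F (matrixUnits b) at h
    induction h using Submodule.span_induction with
    | mem x hx =>
      obtain ⟨u, v, -, rfl⟩ := hx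
      refine ⟨v + 1, fun k hk => ?_⟩
      rw [matrixUnit_apply_basis, if_neg (by omega)]
    | zero => exact ⟨0, fun _ _ => rfl⟩
    | add x y _ _ hx hy =>
      obtain ⟨N, hN⟩ := hx
      obtain ⟨M, hM⟩ := hy
      refine ⟨max N M, fun k hk => ?_⟩
      rw [LinearMap.add_apply, hN k (le_of_max_le_left hk), hM k (le_of_max_le_right hk), add_zero]
    | smul c x _ hx =>
      obtain ⟨N, hN⟩ := hx
      exact ⟨N, fun k hk => by rw [LinearMap.smul_apply, hN k hk, smul_zero]⟩
  · rintro ⟨h, N, hN⟩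
    rw [mem_fullUT_iff] at h
    have ht : t = ∑ k ∈ Finset.range N, ∑ i ∈ Finset.range (k + 1),
        entry b i k t • matrixUnit b i k := by
      refine ext_entry b fun i k => ?_
      simp only [map_sum, map_smul, entry_matrixUnit, smul_eq_mul, ite_and, mul_ite, mul_one,
        mul_zero]
      by_cases hk : k < N
      · rw [Finset.sum_eq_single k (fun l _ hl => by simp [Ne.symm hl])
          (fun h => absurd (Finset.mem_range.2 hk) h)]
        by_cases hi : i ≤ k
        · simp [hi]
        · simp [hi, h i k (not_le.1 hi)]
      · rw [entry_apply, hN k (not_lt.1 hk), map_zero]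
        refine (Finset.sum_eq_zero fun l hl => Finset.sum_eq_zero fun m _ => ?_).symm
        rw [Finset.mem_range] at hl
        simp [show k ≠ l by omega]
    rw [ht]
    change _ ∈ Submodule.span F (matrixUnits b)
    refine sum_mem fun k _ => sum_mem fun i hi => Submodule.smul_mem _ _
      (Submodule.subset_span ⟨i, k, ?_, rfl⟩)
    rw [Finset.mem_range] at hi
    omega

/-! ### Inverting unitriangular endomorphisms. -/

theorem exists_coord_eq_zero (b : Module.Basis ℕ F V) (x : V) :
    ∃ n, ∀ i, n ≤ i → b.coord i x = 0 := by
  refine ⟨(b.repr x).support.sup id + 1, fun i hi => ?_⟩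
  by_contra hc
  have h : i ≤ (b.repr x).support.sup id :=
    Finset.le_sup (f := id) (Finsupp.mem_support_iff.2 hc)
  exact absurd (hi.trans h) (Nat.not_succ_le_self _)

theorem coord_apply_eq_zero_of_mem_fullUT (b : Module.Basis ℕ F V) {t : Module.End F V}
    (ht : t ∈ fullUT b) {n : ℕ} {x : V} (hx : ∀ i, n ≤ i → b.coord i x = 0) {i : ℕ}
    (hi : n ≤ i) : b.coord i (t x) = 0 := by
  refine apply_eq_zero b (b.coord i ∘ₗ t) x fun l => ?_
  by_cases hl : n ≤ l
  · exact Or.inr (hx l hl)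
  · exact Or.inl ((mem_fullUT_iff b).1 ht i l (by omega))

/-- An upper triangular endomorphism with ones on the diagonal is invertible, and its inverse is
upper triangular. -/
theorem exists_linearEquiv_of_unitriangular (b : Module.Basis ℕ F V) {t : Module.End F V}
    (ht : t ∈ fullUT b) (h1 : ∀ i, entry b i i t = 1) :
    ∃ e : V ≃ₗ[F] V, (e : V →ₗ[F] V) = t ∧ (e.symm : V →ₗ[F] V) ∈ fullUT b := by
  -- Back substitution: subtracting a multiple of y (b n) kills the top coordinate. It is used with
  -- y = t for surjectivity and with y = 1 for injectivity.
  have hsub : ∀ (n : ℕ) (x : V) (c : F), (∀ i, n + 1 ≤ i → b.coord i x = 0) → c = b.coord n x →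
      ∀ y ∈ fullUT b, entry b n n y = 1 → ∀ i, n ≤ i → b.coord i (x - c • y (b n)) = 0 := by
    intro n x c hx hc y hy hy1 i hi
    rw [map_sub, map_smul, ← entry_apply]
    rcases hi.eq_or_lt with rfl | hlt
    · rw [hy1, hc]; simp
    · rw [hx i hlt, (mem_fullUT_iff b).1 hy i n hlt]; simp
  have hone : (1 : Module.End F V) ∈ fullUT b := one_mem _
  have hone1 : ∀ n, entry b n n (1 : Module.End F V) = 1 := fun n => by simp [entry_apply]
  have hsurj : ∀ (n : ℕ) (x : V), (∀ i, n ≤ i → b.coord i x = 0) →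
      ∃ y, (∀ i, n ≤ i → b.coord i y = 0) ∧ t y = x := by
    intro n
    induction n with
    | zero =>
      intro x hx
      refine ⟨0, by simp, ?_⟩
      rw [map_zero]
      exact b.ext_elem fun i => by simpa using (hx i (Nat.zero_le _)).symm
    | succ n ih =>
      intro x hx
      obtain ⟨y, hy, hyx⟩ := ih _ (hsub n x _ hx rfl t ht (h1 n))
      refine ⟨y + b.coord n x • b n, fun i hi => ?_, ?_⟩
      · rw [map_add, hy i (by omega), map_smul]
        simp [show n ≠ i by omega]
      · rw [map_add, hyx, map_smul]; simp
  have hinj : ∀ (n : ℕ) (x : V), (∀ i, n ≤ i → b.coord i x = 0) → t x = 0 → x = 0 := by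
    intro n
    induction n with
    | zero =>
      intro x hx _
      exact b.ext_elem fun i => (by simpa using hx i (Nat.zero_le _))
    | succ n ih =>
      intro x hx h0
      have hx' := hsub n x _ hx rfl 1 hone (hone1 n)
      have h2 := coord_apply_eq_zero_of_mem_fullUT b ht hx' le_rfl
      rw [map_sub, h0, Module.End.one_apply, map_smul, map_sub, map_smul, ← entry_apply, h1] at h2
      have h3 : b.coord n x = 0 := by simpa using h2
      exact ih x (fun i hi => by
        rcases hi.eq_or_lt with rfl | hlt
        · exact h3
        · exact hx i hlt) h0
  have hbij : Function.Bijective t := by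
    constructor
    · rw [← LinearMap.ker_eq_bot, LinearMap.ker_eq_bot']
      intro x hx
      obtain ⟨n, hn⟩ := exists_coord_eq_zero b x
      exact hinj n x hn hx
    · intro x
      obtain ⟨n, hn⟩ := exists_coord_eq_zero b x
      obtain ⟨y, -, hy⟩ := hsurj n x hn
      exact ⟨y, hy⟩
  refine ⟨LinearEquiv.ofBijective t hbij, rfl, ?_⟩
  rw [mem_fullUT_iff]
  intro i k hik
  -- The solution produced by back substitution stays below the same bound, so the inverse is upper
  -- triangular.
  obtain ⟨y, hy, hyx⟩ := hsurj (k + 1) (b k) fun i hi => by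
    simp [show k ≠ i by omega]
  rw [entry_apply, LinearEquiv.coe_coe,
    show (LinearEquiv.ofBijective t hbij).symm (b k) = y by
      rw [LinearEquiv.symm_apply_eq]; exact hyx.symm]
  exact hy i hik

end Entries

/-! ### Homogeneous subspaces of triangular algebras -/

section Homogeneous

variable {F V G : Type*} [Field F] [AddCommGroup V] [Module F V] [Group G]

/-- The elements of `A` whose rows with index at least `j` vanish. -/
def rowsLT (b : Module.Basis ℕ F V) (A : NonUnitalSubalgebra F (Module.End F V)) (j : ℕ) :
    Submodule F A where
  carrier := {x | ∀ i k, j ≤ i → entry b i k (x : Module.End F V) = 0}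
  add_mem' := fun hx hy i k hi => by
    rw [NonUnitalSubalgebra.coe_add, map_add, hx i k hi, hy i k hi, add_zero]
  zero_mem' := fun i k _ => by rw [NonUnitalSubalgebra.coe_zero, map_zero]
  smul_mem' := fun c x hx i k hi => by
    rw [NonUnitalSubalgebra.coe_smul, map_smul, hx i k hi, smul_zero]

/-- The elements of `A` whose columns with index less than `j` vanish. -/
def colsGE (b : Module.Basis ℕ F V) (A : NonUnitalSubalgebra F (Module.End F V)) (j : ℕ) :
    Submodule F A where
  carrier := {x | ∀ i k, k < j → entry b i k (x : Module.End F V) = 0}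
  add_mem' := fun hx hy i k hi => by
    rw [NonUnitalSubalgebra.coe_add, map_add, hx i k hi, hy i k hi, add_zero]
  zero_mem' := fun i k _ => by rw [NonUnitalSubalgebra.coe_zero, map_zero]
  smul_mem' := fun c x hx i k hi => by
    rw [NonUnitalSubalgebra.coe_smul, map_smul, hx i k hi, smul_zero]

variable {b : Module.Basis ℕ F V} {A : NonUnitalSubalgebra F (Module.End F V)}

/-- The matrix unit as an element of an algebra containing all upper triangular matrix units. -/
noncomputable def unitOf (hA : limUT b ≤ A) {u v : ℕ} (h : u ≤ v) : A :=
  ⟨matrixUnit b u v, hA (matrixUnit_mem_limUT b h)⟩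

theorem coe_unitOf (hA : limUT b ≤ A) {u v : ℕ} (h : u ≤ v) :
    (unitOf hA h : Module.End F V) = matrixUnit b u v := rfl

theorem unitOf_mul_unitOf (hA : limUT b ≤ A) {u v w : ℕ} (h : u ≤ v) (h' : v ≤ w) :
    unitOf hA h * unitOf hA h' = unitOf hA (h.trans h') :=
  Subtype.ext (by
    rw [NonUnitalSubalgebra.coe_mul, coe_unitOf, coe_unitOf, coe_unitOf, matrixUnit_mul,
      if_pos rfl])

variable {𝒜 : G → Submodule F A}

/-! ### Graded row ideals and their annihilators. -/

/-- Let p and q record the (j, j) entries of the components of e_{jj} and e_{jk}. From e_{jj} e_{jk}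
= e_{jk}, q is the convolution of p with q. Translation invariance of p turns this into p(1) times
the sum of q, which is the (j, j) entry of e_{jk}, namely 0. -/
theorem entry_proj_unitOf_eq_zero (h : IsGroupGrading 𝒜) (hA : limUT b ≤ A)
    (hA' : A ≤ (fullUT b).toNonUnitalSubalgebra) {j : ℕ}
    (hj : ∀ x ∈ rowsLT b A j, ∀ g, h.proj g x ∈ rowsLT b A j) {k : ℕ} (hjk : j < k) (g : G) :
    entry b j j (h.proj g (unitOf hA hjk.le) : Module.End F V) = 0 := by
  have ut : ∀ (x : A) (i k : ℕ), k < i → entry b i k (x : Module.End F V) = 0 :=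
    fun x => (mem_fullUT_iff b).1 (hA' x.2)
  have diag : ∀ x y : A, entry b j j ((x * y : A) : Module.End F V) =
      entry b j j (x : Module.End F V) * entry b j j (y : Module.End F V) := by
    intro x y
    rw [NonUnitalSubalgebra.coe_mul]
    refine entry_mul_eq_single b j fun l hl => ?_
    rcases lt_or_gt_of_ne hl with hl | hl
    · exact Or.inl (ut x _ _ hl)
    · exact Or.inr (ut y _ _ hl)
  set p : G → F := fun g => entry b j j (h.proj g (unitOf hA (le_refl j)) : Module.End F V)
    with hp
  set q : G → F := fun g => entry b j j (h.proj g (unitOf hA hjk.le) : Module.End F V) with hq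
  -- Modulo the graded subspace `rowsLT b A j`, left multiplication by a acts on e_{jj} as the
  -- scalar a_{jj}, while it shifts degrees by l. If that scalar is nonzero, p is invariant under l.
  have inv : ∀ (l : G) (a : A), a ∈ 𝒜 l → entry b j j (a : Module.End F V) ≠ 0 →
      ∀ g, p (l * g) = p g := by
    intro l a ha hne g
    have h1 : a * unitOf hA (le_refl j) - entry b j j (a : Module.End F V) • unitOf hA (le_refl j)
        ∈ rowsLT b A j := by
      intro i m hi
      rw [NonUnitalSubalgebra.coe_sub, NonUnitalSubalgebra.coe_mul, NonUnitalSubalgebra.coe_smul,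
        coe_unitOf, map_sub, map_smul, entry_mul_matrixUnit, entry_matrixUnit]
      rcases hi.eq_or_lt with rfl | hlt
      · by_cases hm : m = j <;> simp [hm]
      · simp [ut a i j hlt, hlt.ne']
    have h2 := hj _ h1 (l * g) j j le_rfl
    rw [map_sub, map_smul, h.proj_mul_left ha, NonUnitalSubalgebra.coe_sub, map_sub, diag,
      NonUnitalSubalgebra.coe_smul, map_smul, smul_eq_mul, ← mul_sub] at h2
    exact (sub_eq_zero.1 ((mul_eq_zero.1 h2).resolve_left hne)).symm
  by_contra hne
  obtain ⟨s, hs⟩ := h.exists_sum_proj (unitOf hA hjk.le)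
  have hsum : ∑ l ∈ s, q l = 0 := by
    have h1 := congrArg (fun x : A => entry b j j (x : Module.End F V)) hs
    simp only [coe_unitOf, entry_matrixUnit, hjk.ne, and_false, if_false] at h1
    rw [AddSubmonoidClass.coe_finsetSum, map_sum] at h1
    exact h1.symm
  have hconv : q g = ∑ l ∈ s, p (g * l⁻¹) * q l := by
    have h1 : unitOf hA hjk.le =
        ∑ l ∈ s, unitOf hA (le_refl j) * h.proj l (unitOf hA hjk.le) := by
      rw [← Finset.mul_sum, ← hs, unitOf_mul_unitOf]
    have h2 : ∀ l, h.proj g (unitOf hA (le_refl j) * h.proj l (unitOf hA hjk.le)) =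
        h.proj (g * l⁻¹) (unitOf hA (le_refl j)) * h.proj l (unitOf hA hjk.le) := by
      intro l
      have := h.proj_mul_right (h.proj_mem l (unitOf hA hjk.le)) (g * l⁻¹)
        (unitOf hA (le_refl j))
      rwa [inv_mul_cancel_right] at this
    have h3 := congrArg (fun x : A => entry b j j (h.proj g x : Module.End F V)) h1
    simp only [map_sum, h2] at h3
    rw [AddSubmonoidClass.coe_finsetSum, map_sum] at h3
    simpa only [diag] using h3
  -- Invariance applies to g since q(g) ≠ 0 by contradiction hypothesis, and to l whenever q(l) ≠ 0.
  have hconst : ∀ l, p (g * l⁻¹) * q l = p 1 * q l := by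
    intro l
    by_cases hl : q l = 0
    · rw [hl, mul_zero, mul_zero]
    · rw [inv g _ (h.proj_mem _ _) hne, ← inv l _ (h.proj_mem _ _) hl l⁻¹, mul_inv_cancel]
  apply hne
  change q g = 0
  rw [hconv, Finset.sum_congr rfl fun l _ => hconst l, ← Finset.mul_sum, hsum, mul_zero]

/-- The elements with nonzero entries in the first `j` rows only form a homogeneous ideal. -/
theorem proj_mem_rowsLT (h : IsGroupGrading 𝒜) (hA : limUT b ≤ A)
    (hA' : A ≤ (fullUT b).toNonUnitalSubalgebra) (j : ℕ) :
    ∀ x ∈ rowsLT b A j, ∀ g, h.proj g x ∈ rowsLT b A j := by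
  have ut : ∀ (x : A) (i k : ℕ), k < i → entry b i k (x : Module.End F V) = 0 :=
    fun x => (mem_fullUT_iff b).1 (hA' x.2)
  induction j with
  | zero =>
    intro x hx g
    have h0 : x = 0 := Subtype.ext (ext_entry b fun i k => by
      rw [hx i k (Nat.zero_le _), NonUnitalSubalgebra.coe_zero, map_zero])
    rw [h0, map_zero]
    exact zero_mem _
  | succ j ih =>
    intro z hz g k m hk
    have hjk : j < k := hk
    -- As z has rows up to j only, row j of the product could come only from the (j, j) entry of the
    -- left factor, which vanishes.
    have h1 : ∀ l, h.proj l (unitOf hA hjk.le) * z ∈ rowsLT b A j := by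
      intro l i n hi
      rw [NonUnitalSubalgebra.coe_mul]
      refine entry_mul_eq_zero b fun r => ?_
      by_cases hr : j + 1 ≤ r
      · exact Or.inr (hz r n hr)
      left
      rcases (show r ≤ j by omega).eq_or_lt with rfl | hlt
      · rcases hi.eq_or_lt with rfl | hlt
        · exact entry_proj_unitOf_eq_zero h hA hA' ih hjk l
        · exact ut _ _ _ hlt
      · exact ut _ _ _ (by omega)
    have h2 : ∀ l, h.proj l (unitOf hA hjk.le) * h.proj g z ∈ rowsLT b A j := by
      intro l
      rw [← h.proj_mul_left (h.proj_mem l _)]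
      exact ih _ (h1 l) _
    -- Multiplication by e_{jk} moves row k of the component of z into row j, where everything must
    -- vanish.
    have h3 : unitOf hA hjk.le * h.proj g z ∈ rowsLT b A j := by
      obtain ⟨s, hs⟩ := h.exists_sum_proj (unitOf hA hjk.le)
      rw [hs, Finset.sum_mul]
      exact sum_mem fun l _ => h2 l
    have h4 := h3 j m le_rfl
    rwa [NonUnitalSubalgebra.coe_mul, coe_unitOf, entry_matrixUnit_mul, if_pos rfl] at h4

/-- An element lies in `colsGE b A j` if and only if it annihilates `rowsLT b A j` from the
left. -/
theorem mem_colsGE_iff_mul_eq_zero (hA : limUT b ≤ A) {j : ℕ} {x : A} :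
    x ∈ colsGE b A j ↔ ∀ r ∈ rowsLT b A j, x * r = 0 := by
  constructor
  · intro hx r hr
    refine Subtype.ext (ext_entry b fun i k => ?_)
    rw [NonUnitalSubalgebra.coe_mul, NonUnitalSubalgebra.coe_zero, map_zero]
    refine entry_mul_eq_zero b fun l => ?_
    rcases lt_or_ge l j with hl | hl
    · exact Or.inl (hx i l hl)
    · exact Or.inr (hr l k hl)
  · intro hx i k hk
    have h1 := congrArg (fun y : A => entry b i k (y : Module.End F V))
      (hx (unitOf hA (le_refl k)) fun m n hm => by
        rw [coe_unitOf, entry_matrixUnit, if_neg (by omega)])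
    simp only [NonUnitalSubalgebra.coe_mul, coe_unitOf, NonUnitalSubalgebra.coe_zero,
      map_zero] at h1
    rwa [entry_mul_matrixUnit, if_pos rfl] at h1

/-- The left annihilator of a graded subspace is graded: for homogeneous r, the products of r with
the components of x are the components of x r. -/
theorem proj_mem_colsGE (h : IsGroupGrading 𝒜) (hA : limUT b ≤ A)
    (hA' : A ≤ (fullUT b).toNonUnitalSubalgebra) (j : ℕ) :
    ∀ x ∈ colsGE b A j, ∀ g, h.proj g x ∈ colsGE b A j := by
  intro x hx g
  rw [mem_colsGE_iff_mul_eq_zero hA] at hx ⊢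
  intro r hr
  obtain ⟨s, hs⟩ := h.exists_sum_proj r
  rw [hs, Finset.mul_sum]
  refine Finset.sum_eq_zero fun l _ => ?_
  rw [← h.proj_mul_right (h.proj_mem l _), hx _ (proj_mem_rowsLT h hA hA' j r hr l), map_zero]

/-- A criterion for homogeneity in terms of the action on the first row. -/
theorem mem_of_forall_mul_mem (h : IsGroupGrading 𝒜) (hA : limUT b ≤ A)
    (hA' : A ≤ (fullUT b).toNonUnitalSubalgebra) {k : G} {a : A}
    (ha : ∀ g, ∀ w ∈ rowsLT b A 1, w ∈ 𝒜 g → w * a ∈ 𝒜 (g * k)) : a ∈ 𝒜 k := by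
  refine h.mem_of_forall_proj_eq_zero fun l hl => ?_
  have h1 : ∀ w ∈ rowsLT b A 1, w * h.proj l a = 0 := by
    intro w hw
    obtain ⟨s, hs⟩ := h.exists_sum_proj w
    rw [hs, Finset.sum_mul]
    refine Finset.sum_eq_zero fun g _ => ?_
    rw [← h.proj_mul_left (h.proj_mem g _)]
    exact h.proj_of_mem_ne (ha g _ (proj_mem_rowsLT h hA hA' 1 w hw g) (h.proj_mem g w))
      (by simpa using hl)
  refine Subtype.ext (ext_entry b fun i m => ?_)
  -- Faithfulness of the first row: e_{0i} copies row i into row 0.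
  have h2 := congrArg (fun y : A => entry b 0 m (y : Module.End F V))
    (h1 (unitOf hA (Nat.zero_le i)) fun u v hu => by
      rw [coe_unitOf, entry_matrixUnit, if_neg (by omega)])
  simp only [NonUnitalSubalgebra.coe_mul, coe_unitOf, entry_matrixUnit_mul, if_true] at h2
  rw [h2, NonUnitalSubalgebra.coe_zero, map_zero, map_zero]

/-- The first row contains a homogeneous element with leading entry `1` in any given position. -/
theorem exists_homogeneous_leading (h : IsGroupGrading 𝒜) (hA : limUT b ≤ A)
    (hA' : A ≤ (fullUT b).toNonUnitalSubalgebra) (i : ℕ) :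
    ∃ (g : G) (r : A), r ∈ 𝒜 g ∧ r ∈ rowsLT b A 1 ∧ r ∈ colsGE b A i ∧
      entry b 0 i (r : Module.End F V) = 1 := by
  set e := unitOf hA (Nat.zero_le i)
  have he : e ∈ rowsLT b A 1 := fun u v hu => by
    rw [coe_unitOf, entry_matrixUnit, if_neg (by omega)]
  have he' : e ∈ colsGE b A i := fun u v hu => by
    rw [coe_unitOf, entry_matrixUnit, if_neg (by omega)]
  -- The (0, i) entries of the components of e_{0i} sum to 1, so they cannot all vanish.
  obtain ⟨g, hg⟩ : ∃ g, entry b 0 i (h.proj g e : Module.End F V) ≠ 0 := by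
    by_contra! hc
    obtain ⟨s, hs⟩ := h.exists_sum_proj e
    have h1 := congrArg (fun y : A => entry b 0 i (y : Module.End F V)) hs
    simp only [e, coe_unitOf, entry_matrixUnit] at h1
    rw [AddSubmonoidClass.coe_finsetSum, map_sum, Finset.sum_eq_zero fun g _ => hc g] at h1
    simp at h1
  refine ⟨g, (entry b 0 i (h.proj g e : Module.End F V))⁻¹ • h.proj g e,
    Submodule.smul_mem _ _ (h.proj_mem _ _),
    Submodule.smul_mem _ _ (proj_mem_rowsLT h hA hA' 1 e he g),
    Submodule.smul_mem _ _ (proj_mem_colsGE h hA hA' i e he' g), ?_⟩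
  rw [NonUnitalSubalgebra.coe_smul, map_smul, smul_eq_mul, inv_mul_cancel₀ hg]

end Homogeneous

/-! ### Homogeneous frames of the first row -/

section Frames

variable {F V G : Type*} [Field F] [AddCommGroup V] [Module F V]
  {b : Module.Basis ℕ F V} {A : NonUnitalSubalgebra F (Module.End F V)}

/-- A sequence of homogeneous elements of the first row whose `i`-th term has its leading entry,
equal to `1`, in position `i`. -/
structure IsHomogeneousFrame (b : Module.Basis ℕ F V)
    {A : NonUnitalSubalgebra F (Module.End F V)} (𝒜 : G → Submodule F A) (γ : ℕ → G)
    (r : ℕ → A) : Prop where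
  homogeneous : ∀ i, r i ∈ 𝒜 (γ i)
  mem_rowsLT : ∀ i, r i ∈ rowsLT b A 1
  mem_colsGE : ∀ i, r i ∈ colsGE b A i
  leading : ∀ i, entry b 0 i (r i : Module.End F V) = 1

/-- The endomorphism whose `i`-th row is the first row of `r i`, provided that this is upper
triangular. -/
noncomputable def frameMap (b : Module.Basis ℕ F V)
    {A : NonUnitalSubalgebra F (Module.End F V)} (r : ℕ → A) : Module.End F V :=
  b.constr F fun j => ∑ i ∈ Finset.range (j + 1), entry b 0 j (r i : Module.End F V) • b i

theorem eq_of_mem_rowsLT_one {x y : A} (hx : x ∈ rowsLT b A 1) (hy : y ∈ rowsLT b A 1)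
    (h : ∀ k, entry b 0 k (x : Module.End F V) = entry b 0 k (y : Module.End F V)) : x = y :=
  Subtype.ext (ext_entry b fun i k => by
    rcases Nat.eq_zero_or_pos i with rfl | hi
    · exact h k
    · rw [hx i k hi, hy i k hi])

namespace IsHomogeneousFrame

variable {𝒜 : G → Submodule F A} {γ : ℕ → G} {r : ℕ → A}

/-- The sum defining `frameMap` stops at i = j without loss, because r_i has no entries to the left
of position i. -/
theorem entry_frameMap (hr : IsHomogeneousFrame b 𝒜 γ r) (i j : ℕ) :
    entry b i j (frameMap b r) = entry b 0 j (r i : Module.End F V) := by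
  rw [entry_apply, frameMap, Module.Basis.constr_basis]
  simp only [map_sum, map_smul, Module.Basis.coord_apply, Module.Basis.repr_self, smul_eq_mul,
    Finsupp.single_apply, mul_ite, mul_one, mul_zero]
  rw [Finset.sum_ite_eq' (Finset.range (j + 1)) i]
  split_ifs with h
  · rfl
  · exact (hr.mem_colsGE i 0 j (by simpa [Nat.lt_succ_iff] using h)).symm

theorem coord_frameMap (hr : IsHomogeneousFrame b 𝒜 γ r) (i : ℕ) (v : V) :
    b.coord i (frameMap b r v) = b.coord 0 ((r i : Module.End F V) v) := by
  have h : b.coord i ∘ₗ frameMap b r = b.coord 0 ∘ₗ (r i : Module.End F V) :=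
    b.ext fun j => hr.entry_frameMap i j
  exact LinearMap.congr_fun h v

theorem frameMap_mem_fullUT (hr : IsHomogeneousFrame b 𝒜 γ r) : frameMap b r ∈ fullUT b :=
  (mem_fullUT_iff b).2 fun i k hk => by rw [hr.entry_frameMap]; exact hr.mem_colsGE i 0 k hk

theorem exists_linearEquiv (hr : IsHomogeneousFrame b 𝒜 γ r) :
    ∃ e : V ≃ₗ[F] V, (e : V →ₗ[F] V) = frameMap b r ∧ (e.symm : V →ₗ[F] V) ∈ fullUT b :=
  exists_linearEquiv_of_unitriangular b hr.frameMap_mem_fullUT fun i => by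
    rw [hr.entry_frameMap, hr.leading]

/-! ### Frame coordinates and degrees. -/

variable {e : V ≃ₗ[F] V}

theorem basis_eq_sum (he : (e : V →ₗ[F] V) = frameMap b r) (m : ℕ) :
    b m = ∑ k ∈ Finset.range (m + 1), entry b 0 m (r k : Module.End F V) • e.symm (b k) := by
  have h : e (b m) = ∑ k ∈ Finset.range (m + 1), entry b 0 m (r k : Module.End F V) • b k := by
    rw [← LinearEquiv.coe_coe, he, frameMap, Module.Basis.constr_basis]
  rw [← e.symm_apply_apply (b m), h, map_sum]
  simp only [map_smul]

/-- The frame coordinates of the first row of w are the entries of that row of w e⁻¹. Since r_k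
starts in position k, each entry is a finite sum even if infinitely many coordinates are nonzero. -/
theorem entry_eq_sum (hr : IsHomogeneousFrame b 𝒜 γ r) (he : (e : V →ₗ[F] V) = frameMap b r)
    (w : Module.End F V) {m n : ℕ} (h : m < n) :
    entry b 0 m w = ∑ k ∈ Finset.range n,
      b.coord 0 (w (e.symm (b k))) * entry b 0 m (r k : Module.End F V) := by
  rw [entry_apply]
  conv_lhs => rw [basis_eq_sum he m]
  simp only [map_sum, map_smul, smul_eq_mul]
  rw [← Finset.sum_subset (Finset.range_mono (show m + 1 ≤ n by omega))]
  · exact Finset.sum_congr rfl fun _ _ => mul_comm _ _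
  · intro k _ hk
    rw [Finset.mem_range, not_lt] at hk
    rw [hr.mem_colsGE k 0 m (by omega), mul_zero]

theorem conj_matrixUnit_apply (hr : IsHomogeneousFrame b 𝒜 γ r)
    (he : (e : V →ₗ[F] V) = frameMap b r) (i j : ℕ) (v : V) :
    e.symm (matrixUnit b i j (e v)) =
      b.coord 0 ((r j : Module.End F V) v) • e.symm (b i) := by
  rw [matrixUnit, LinearMap.smulRight_apply, map_smul, ← hr.coord_frameMap, ← he,
    LinearEquiv.coe_coe]

variable [Group G]

/-- A homogeneous element of the first row is a combination of frame elements of the same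
degree. -/
theorem degree_eq (hr : IsHomogeneousFrame b 𝒜 γ r) (h : IsGroupGrading 𝒜) (hA : limUT b ≤ A)
    (hA' : A ≤ (fullUT b).toNonUnitalSubalgebra) (he : (e : V →ₗ[F] V) = frameMap b r)
    {g : G} {w : A} (hw : w ∈ rowsLT b A 1) (hg : w ∈ 𝒜 g) (i : ℕ)
    (hi : b.coord 0 ((w : Module.End F V) (e.symm (b i))) ≠ 0) : γ i = g := by
  induction i using Nat.strong_induction_on with
  | _ i ih =>
    set c : ℕ → F := fun k => b.coord 0 ((w : Module.End F V) (e.symm (b k))) with hc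
    -- By induction the subtracted terms have degree g, so w' is still homogeneous; its leading term
    -- is now c_i in position i.
    set w' : A := w - ∑ k ∈ Finset.range i, c k • r k with hw'
    have hw'g : w' ∈ 𝒜 g := by
      refine sub_mem hg (sum_mem fun k hk => ?_)
      by_cases hck : c k = 0
      · rw [hck, zero_smul]; exact zero_mem _
      · exact Submodule.smul_mem _ _ (ih k (Finset.mem_range.1 hk) hck ▸ hr.homogeneous k)
    have hw'1 : w' ∈ rowsLT b A 1 :=
      sub_mem hw (sum_mem fun k _ => Submodule.smul_mem _ _ (hr.mem_rowsLT k))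
    have hentry : ∀ m, entry b 0 m (w' : Module.End F V) =
        entry b 0 m (w : Module.End F V) -
          ∑ k ∈ Finset.range i, c k * entry b 0 m (r k : Module.End F V) := by
      intro m
      rw [hw', NonUnitalSubalgebra.coe_sub, AddSubmonoidClass.coe_finsetSum, map_sub, map_sum]
      simp only [NonUnitalSubalgebra.coe_smul, map_smul, smul_eq_mul]
    have hlt : ∀ m, m < i → entry b 0 m (w' : Module.End F V) = 0 := by
      intro m hm
      rw [hentry, hr.entry_eq_sum he _ hm, sub_self]
    have hii : entry b 0 i (w' : Module.End F V) = c i := by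
      rw [hentry, hr.entry_eq_sum he _ (Nat.lt_succ_self i), Finset.sum_range_succ,
        add_sub_cancel_left, hr.leading, mul_one]
    by_contra hne
    -- The leading entries cancel. If the two degrees differed, r_i would be a component of this
    -- difference and would itself lie in the graded subspace, losing its leading 1.
    have hcols : r i - (c i)⁻¹ • w' ∈ colsGE b A (i + 1) := by
      intro u m hm
      rw [NonUnitalSubalgebra.coe_sub, NonUnitalSubalgebra.coe_smul, map_sub, map_smul]
      rcases Nat.eq_zero_or_pos u with rfl | hu
      · rcases (show m ≤ i by omega).eq_or_lt with rfl | hmi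
        · rw [hr.leading, hii, smul_eq_mul, inv_mul_cancel₀ hi, sub_self]
        · rw [hr.mem_colsGE i 0 m hmi, hlt m hmi, smul_zero, sub_self]
      · rw [hr.mem_rowsLT i u m hu, hw'1 u m hu, smul_zero, sub_self]
    have h1 := proj_mem_colsGE h hA hA' _ _ hcols (γ i)
    rw [map_sub, map_smul, h.proj_of_mem (hr.homogeneous i), h.proj_of_mem_ne hw'g hne, smul_zero,
      sub_zero] at h1
    have h2 := h1 0 i (Nat.lt_succ_self i)
    rw [hr.leading] at h2
    exact one_ne_zero h2

/-- A row w is sent to c_i(w) r_j. For w of degree g this is zero unless γ i = g, so the degree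
always shifts by (γ i)⁻¹ γ j. -/
theorem conj_matrixUnit_mem (hr : IsHomogeneousFrame b 𝒜 γ r) (h : IsGroupGrading 𝒜)
    (hA : limUT b ≤ A) (hA' : A ≤ (fullUT b).toNonUnitalSubalgebra)
    (he : (e : V →ₗ[F] V) = frameMap b r) {i j : ℕ} {x : A}
    (hx : ∀ v, (x : Module.End F V) v = e.symm (matrixUnit b i j (e v))) :
    x ∈ 𝒜 ((γ i)⁻¹ * γ j) := by
  refine mem_of_forall_mul_mem h hA hA' fun g w hw hg => ?_
  have hwx : w * x = b.coord 0 ((w : Module.End F V) (e.symm (b i))) • r j := by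
    refine eq_of_mem_rowsLT_one ?_ (Submodule.smul_mem _ _ (hr.mem_rowsLT j)) fun k => ?_
    · intro u v hu
      rw [NonUnitalSubalgebra.coe_mul]
      exact entry_mul_eq_zero b fun l => Or.inl (hw u l hu)
    · rw [NonUnitalSubalgebra.coe_mul, NonUnitalSubalgebra.coe_smul, map_smul, entry_apply,
        Module.End.mul_apply, hx, hr.conj_matrixUnit_apply he, map_smul, map_smul, smul_eq_mul,
        smul_eq_mul, mul_comm, entry_apply]
  rw [hwx]
  by_cases hc : b.coord 0 ((w : Module.End F V) (e.symm (b i))) = 0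
  · rw [hc, zero_smul]; exact zero_mem _
  · rw [← hr.degree_eq h hA hA' he hw hg i hc, mul_inv_cancel_left]
    exact Submodule.smul_mem _ _ (hr.homogeneous j)

/-- Conjugation by the frame turns the grading into an elementary one. -/
theorem exists_elementary (hr : IsHomogeneousFrame b 𝒜 γ r) (h : IsGroupGrading 𝒜)
    (hA : limUT b ≤ A) (hA' : A ≤ (fullUT b).toNonUnitalSubalgebra)
    (he : (e : V →ₗ[F] V) = frameMap b r)
    (hconj : ∀ x ∈ A, (e : V →ₗ[F] V) * x * (e.symm : V →ₗ[F] V) ∈ A)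
    (hconj' : ∀ x ∈ A, (e.symm : V →ₗ[F] V) * x * (e : V →ₗ[F] V) ∈ A) :
    ∃ ℬ : G → Submodule F A,
      IsGroupGrading ℬ ∧ IsElementaryGrading b ℬ ∧ GradingIso 𝒜 ℬ := by
  let f : A ≃ₗ[F] A :=
    { toFun := fun x => ⟨_, hconj x x.2⟩
      invFun := fun x => ⟨_, hconj' x x.2⟩
      map_add' := fun x y => Subtype.ext (LinearMap.ext fun v => by
        simp [Module.End.mul_apply])
      map_smul' := fun c x => Subtype.ext (LinearMap.ext fun v => by
        simp [Module.End.mul_apply])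
      left_inv := fun x => Subtype.ext (LinearMap.ext fun v => by
        simp [Module.End.mul_apply])
      right_inv := fun x => Subtype.ext (LinearMap.ext fun v => by
        simp [Module.End.mul_apply]) }
  have hf : ∀ x y, f (x * y) = f x * f y := fun x y => Subtype.ext (LinearMap.ext fun v => by
    simp [f, Module.End.mul_apply])
  refine ⟨fun g => (𝒜 g).map (f : A →ₗ[F] A), h.map f hf, ⟨γ, fun i j hij hmem => ?_⟩,
    ⟨{ toFun := f
       map_smul' := fun c x => map_smul f c x
       map_zero' := map_zero f
       map_add' := map_add f
       map_mul' := hf }, f.bijective, fun g x hx => ⟨x, hx, rfl⟩⟩⟩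
  refine ⟨f.symm ⟨matrixUnit b i j, hmem⟩, ?_, f.apply_symm_apply _⟩
  exact hr.conj_matrixUnit_mem h hA hA' he fun v => rfl

end IsHomogeneousFrame

/-! ### Existence of frames, finite support, and elementary gradings. -/

variable [Group G]

theorem IsGroupGrading.exists_isHomogeneousFrame {𝒜 : G → Submodule F A} (h : IsGroupGrading 𝒜)
    (hA : limUT b ≤ A) (hA' : A ≤ (fullUT b).toNonUnitalSubalgebra) :
    ∃ (γ : ℕ → G) (r : ℕ → A), IsHomogeneousFrame b 𝒜 γ r := by
  choose γ r h1 h2 h3 h4 using exists_homogeneous_leading h hA hA'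
  exact ⟨γ, r, h1, h2, h3, h4⟩

/-- Gradings of the full upper triangular algebra have finite support. -/
theorem finite_gradingSupport_fullUT
    {𝒜 : G → Submodule F (fullUT b).toNonUnitalSubalgebra} (h : IsGroupGrading 𝒜) :
    (gradingSupport 𝒜).Finite := by
  have hA := limUT_le_fullUT b
  obtain ⟨γ, r, hr⟩ := h.exists_isHomogeneousFrame hA le_rfl
  obtain ⟨e, he, -⟩ := hr.exists_linearEquiv
  -- A row with infinitely many nonzero entries is allowed in the full algebra, so all frame
  -- coordinates can be 1 at once.
  obtain ⟨w, hw, hw1⟩ : ∃ w : (fullUT b).toNonUnitalSubalgebra, w ∈ rowsLT b _ 1 ∧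
      ∀ j, b.coord 0 ((w : Module.End F V) (e.symm (b j))) = 1 := by
    let t : Module.End F V := (b.constr F (fun _ => (1 : F)) ∘ₗ (e : V →ₗ[F] V)).smulRight (b 0)
    have ht : ∀ i k, 1 ≤ i → entry b i k t = 0 := fun i k hi => by
      simp [t, entry_apply, show 0 ≠ i by omega]
    refine ⟨⟨t, (mem_fullUT_iff b).2 fun i k hk => ht i k (by omega)⟩, ht, fun j => ?_⟩
    simp [t]
  obtain ⟨s, hs⟩ := h.exists_sum_proj w
  have hγ : ∀ j, γ j ∈ s := by
    intro j
    have h1 : ∃ g ∈ s, b.coord 0 ((h.proj g w : Module.End F V) (e.symm (b j))) ≠ 0 := by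
      by_contra! hc
      have h2 := hw1 j
      rw [hs, AddSubmonoidClass.coe_finsetSum, LinearMap.sum_apply, map_sum,
        Finset.sum_eq_zero hc] at h2
      exact zero_ne_one h2
    obtain ⟨g, hgs, hg⟩ := h1
    rwa [hr.degree_eq h hA le_rfl he (proj_mem_rowsLT h hA le_rfl 1 w hw g) (h.proj_mem g w) j hg]
  refine (Set.Finite.image2 (fun x y => x⁻¹ * y) s.finite_toSet s.finite_toSet).subset ?_
  intro g hg
  obtain ⟨a, ha, ha0⟩ := (Submodule.ne_bot_iff _).1 hg
  -- The r_i are the rows of the injective map e, so they cannot all annihilate a from the left.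
  obtain ⟨i, hi⟩ : ∃ i, r i * a ≠ 0 := by
    by_contra! hc
    refine ha0 (Subtype.ext (LinearMap.ext fun v => e.injective (b.ext_elem fun i => ?_)))
    have h1 := congrArg (fun x : (fullUT b).toNonUnitalSubalgebra =>
      b.coord 0 ((x : Module.End F V) v)) (hc i)
    simp only [NonUnitalSubalgebra.coe_mul, Module.End.mul_apply] at h1
    rw [← hr.coord_frameMap, ← he] at h1
    simpa using h1
  have hia : r i * a ∈ rowsLT b _ 1 := fun u v hu => by
    rw [NonUnitalSubalgebra.coe_mul]
    exact entry_mul_eq_zero b fun l => Or.inl (hr.mem_rowsLT i u l hu)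
  obtain ⟨j, hj⟩ : ∃ j, b.coord 0 (((r i * a : (fullUT b).toNonUnitalSubalgebra) :
      Module.End F V) (e.symm (b j))) ≠ 0 := by
    by_contra! hc
    refine hi (eq_of_mem_rowsLT_one hia (zero_mem _) fun k => ?_)
    rw [hr.entry_eq_sum he _ (Nat.lt_succ_self k), NonUnitalSubalgebra.coe_zero, map_zero]
    exact Finset.sum_eq_zero fun l _ => by rw [hc l, zero_mul]
  have hd := hr.degree_eq h hA le_rfl he hia (h.mul_mem _ _ _ _ (hr.homogeneous i) ha) j hj
  exact ⟨γ i, hγ i, γ j, hγ j, by rw [hd]; exact inv_mul_cancel_left _ _⟩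

/-- In the direct limit algebra there is a homogeneous frame spanning the first row. -/
theorem IsGroupGrading.exists_isHomogeneousFrame_span {𝒜 : G → Submodule F (limUT b)}
    (h : IsGroupGrading 𝒜) :
    ∃ (γ : ℕ → G) (r : ℕ → limUT b), IsHomogeneousFrame b 𝒜 γ r ∧
      ∀ x ∈ rowsLT b (limUT b) 1, x ∈ Submodule.span F (Set.range r) := by
  classical
  have hA' := limUT_le_fullUT b
  let p : ℕ → G → ℕ → limUT b → Prop := fun i g N r =>
    (r ∈ 𝒜 g ∧ r ∈ rowsLT b (limUT b) 1 ∧ r ∈ colsGE b (limUT b) i ∧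
      entry b 0 i (r : Module.End F V) = 1) ∧ ∀ k, N ≤ k → entry b 0 k (r : Module.End F V) = 0
  have hex : ∀ i, ∃ N, ∃ g r, p i g N r := by
    intro i
    obtain ⟨g, r, hr⟩ := exists_homogeneous_leading h le_rfl hA' i
    obtain ⟨-, N, hN⟩ := (mem_limUT_iff b).1 r.2
    exact ⟨N, g, r, hr, fun k hk => by rw [entry_apply, hN k hk, map_zero]⟩
  -- Each r_i is chosen with the least length N among homogeneous rows of any degree with leading 1
  -- in position i.
  choose γ r hr using fun i => Nat.find_spec (hex i)
  have frame : IsHomogeneousFrame b 𝒜 γ r :=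
    ⟨fun i => (hr i).1.1, fun i => (hr i).1.2.1, fun i => (hr i).1.2.2.1,
      fun i => (hr i).1.2.2.2⟩
  refine ⟨γ, r, frame, ?_⟩
  -- Elimination inside the window from i to N, by induction on its width d. Minimality keeps r_i
  -- inside the window, so subtracting c r_i creates no entries beyond N.
  have hhom : ∀ (N d i : ℕ), i + d = N → ∀ (g : G) (x : limUT b), x ∈ 𝒜 g →
      x ∈ rowsLT b (limUT b) 1 → x ∈ colsGE b (limUT b) i →
      (∀ k, N ≤ k → entry b 0 k (x : Module.End F V) = 0) →
      x ∈ Submodule.span F (Set.range r) := by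
    intro N d
    induction d with
    | zero =>
      intro i hi g x _ hx1 hxi hxN
      have h0 : x = 0 := eq_of_mem_rowsLT_one hx1 (zero_mem _) fun k => by
        rw [NonUnitalSubalgebra.coe_zero, map_zero]
        rcases lt_or_ge k i with hk | hk
        · exact hxi 0 k hk
        · exact hxN k (by omega)
      rw [h0]; exact zero_mem _
    | succ d ih =>
      intro i hi g x hxg hx1 hxi hxN
      set c := entry b 0 i (x : Module.End F V) with hc
      have step : ∀ y : limUT b, y ∈ 𝒜 g → y ∈ rowsLT b (limUT b) 1 →
          y ∈ colsGE b (limUT b) i → (∀ k, N ≤ k → entry b 0 k (y : Module.End F V) = 0) →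
          entry b 0 i (y : Module.End F V) = 0 → y ∈ Submodule.span F (Set.range r) := by
        intro y hyg hy1 hyi hyN hy0
        refine ih (i + 1) (by omega) g y hyg hy1 (fun u k hk => ?_) hyN
        rcases (show k ≤ i by omega).eq_or_lt with rfl | hlt
        · rcases Nat.eq_zero_or_pos u with rfl | hu
          · exact hy0
          · exact hy1 u k hu
        · exact hyi u k hlt
      by_cases hc0 : c = 0
      · exact step x hxg hx1 hxi hxN hc0
      have hpx : p i g N (c⁻¹ • x) := by
        refine ⟨⟨Submodule.smul_mem _ _ hxg, Submodule.smul_mem _ _ hx1,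
          Submodule.smul_mem _ _ hxi, ?_⟩, fun k hk => ?_⟩
        · rw [NonUnitalSubalgebra.coe_smul, map_smul, smul_eq_mul, inv_mul_cancel₀ hc0]
        · rw [NonUnitalSubalgebra.coe_smul, map_smul, hxN k hk, smul_zero]
      have hle : Nat.find (hex i) ≤ N := Nat.find_le ⟨g, _, hpx⟩
      -- The degree is determined by the leading position, so minimizing over all degrees is
      -- harmless.
      have hγ : γ i = g := by
        by_contra hne
        have hcols : r i - c⁻¹ • x ∈ colsGE b (limUT b) (i + 1) := by
          intro u m hm
          rw [NonUnitalSubalgebra.coe_sub, map_sub]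
          rcases (show m ≤ i by omega).eq_or_lt with rfl | hmi
          · rcases Nat.eq_zero_or_pos u with rfl | hu
            · rw [frame.leading, hpx.1.2.2.2, sub_self]
            · rw [frame.mem_rowsLT m u m hu, hpx.1.2.1 u m hu, sub_self]
          · rw [frame.mem_colsGE i u m hmi, hpx.1.2.2.1 u m hmi, sub_self]
        have h1 := proj_mem_colsGE h le_rfl hA' _ _ hcols (γ i)
        rw [map_sub, h.proj_of_mem (frame.homogeneous i), h.proj_of_mem_ne hpx.1.1 hne,
          sub_zero] at h1
        have h2 := h1 0 i (Nat.lt_succ_self i)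
        rw [frame.leading] at h2
        exact one_ne_zero h2
      have hsub := step (x - c • r i) (sub_mem hxg (Submodule.smul_mem _ _
        (hγ ▸ frame.homogeneous i))) (sub_mem hx1 (Submodule.smul_mem _ _ (frame.mem_rowsLT i)))
        (sub_mem hxi (Submodule.smul_mem _ _ (frame.mem_colsGE i)))
        (fun k hk => by
          rw [NonUnitalSubalgebra.coe_sub, NonUnitalSubalgebra.coe_smul, map_sub, map_smul,
            hxN k hk, (hr i).2 k (hle.trans hk), smul_zero, sub_zero])
        (by
          rw [NonUnitalSubalgebra.coe_sub, NonUnitalSubalgebra.coe_smul, map_sub, map_smul,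
            frame.leading, smul_eq_mul, mul_one, sub_self])
      rw [← sub_add_cancel x (c • r i)]
      exact add_mem hsub (Submodule.smul_mem _ _ (Submodule.subset_span ⟨i, rfl⟩))
  intro x hx
  obtain ⟨s, hs⟩ := h.exists_sum_proj x
  rw [hs]
  refine sum_mem fun g _ => ?_
  obtain ⟨-, N, hN⟩ := (mem_limUT_iff b).1 (h.proj g x).2
  exact hhom N N 0 (zero_add N) g _ (h.proj_mem g x) (proj_mem_rowsLT h le_rfl hA' 1 x hx g)
    (fun u k hk => absurd hk (Nat.not_lt_zero k))
    fun k hk => by rw [entry_apply, hN k hk, map_zero]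

/-- As x has finitely many nonzero columns, only finitely many rows of t enter the product; their
finiteness bounds its nonzero columns. -/
theorem mul_mul_mem_limUT {s x t : Module.End F V} (hs : s ∈ fullUT b) (hx : x ∈ limUT b)
    (ht : t ∈ fullUT b) (hrow : ∀ j, ∃ N, ∀ k, N ≤ k → entry b j k t = 0) :
    s * x * t ∈ limUT b := by
  obtain ⟨hx, N, hN⟩ := (mem_limUT_iff b).1 hx
  refine (mem_limUT_iff b).2 ⟨mul_mem (mul_mem hs hx) ht, ?_⟩
  choose M hM using hrow
  refine ⟨(Finset.range N).sup M, fun k hk => b.ext_elem fun i => ?_⟩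
  rw [map_zero]
  refine entry_mul_eq_zero b (s := s * x) (i := i) fun l => ?_
  rcases lt_or_ge l N with hl | hl
  · exact Or.inr (hM l k ((Finset.le_sup (Finset.mem_range.2 hl)).trans hk))
  · left
    rw [entry_apply, Module.End.mul_apply, hN l hl, map_zero, map_zero]

theorem exists_elementary_limUT {𝒜 : G → Submodule F (limUT b)} (h : IsGroupGrading 𝒜) :
    ∃ ℬ : G → Submodule F (limUT b),
      IsGroupGrading ℬ ∧ IsElementaryGrading b ℬ ∧ GradingIso 𝒜 ℬ := by
  obtain ⟨γ, r, hr, hspan⟩ := h.exists_isHomogeneousFrame_span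
  obtain ⟨e, he, he'⟩ := hr.exists_linearEquiv
  have heUT : (e : V →ₗ[F] V) ∈ fullUT b := he ▸ hr.frameMap_mem_fullUT
  have hrow : ∀ j, ∃ N, ∀ k, N ≤ k → entry b j k (e : V →ₗ[F] V) = 0 := by
    intro j
    obtain ⟨-, N, hN⟩ := (mem_limUT_iff b).1 (r j).2
    exact ⟨N, fun k hk => by rw [he, hr.entry_frameMap, entry_apply, hN k hk, map_zero]⟩
  have hfin : ∀ x ∈ Submodule.span F (Set.range r), ∃ N, ∀ k, N ≤ k →
      b.coord 0 ((x : Module.End F V) (e.symm (b k))) = 0 := by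
    intro x hx
    induction hx using Submodule.span_induction with
    | mem x hx =>
      obtain ⟨i, rfl⟩ := hx
      refine ⟨i + 1, fun k hk => ?_⟩
      rw [← hr.coord_frameMap, ← he]
      simp [show k ≠ i by omega]
    | zero => exact ⟨0, fun k _ => by simp⟩
    | add x y _ _ hx hy =>
      obtain ⟨N, hN⟩ := hx
      obtain ⟨M, hM⟩ := hy
      refine ⟨max N M, fun k hk => ?_⟩
      rw [NonUnitalSubalgebra.coe_add, LinearMap.add_apply, map_add,
        hN k (le_of_max_le_left hk), hM k (le_of_max_le_right hk), add_zero]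
    | smul c x _ hx =>
      obtain ⟨N, hN⟩ := hx
      refine ⟨N, fun k hk => ?_⟩
      rw [NonUnitalSubalgebra.coe_smul, LinearMap.smul_apply, map_smul, hN k hk, smul_zero]
  -- Row j of e⁻¹ lists the frame coordinates of e_{0j}, of which finitely many are nonzero because
  -- the frame spans the first row.
  have hrow' : ∀ j, ∃ N, ∀ k, N ≤ k → entry b j k (e.symm : V →ₗ[F] V) = 0 := by
    intro j
    obtain ⟨N, hN⟩ := hfin _ (hspan (unitOf le_rfl (Nat.zero_le j)) fun u v hu => by
      rw [coe_unitOf, entry_matrixUnit, if_neg (by omega)])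
    refine ⟨N, fun k hk => ?_⟩
    have h1 := hN k hk
    rw [coe_unitOf, matrixUnit, LinearMap.smulRight_apply, map_smul] at h1
    rw [entry_apply]
    simpa using h1
  exact hr.exists_elementary h le_rfl (limUT_le_fullUT b) he
    (fun x hx => mul_mul_mem_limUT heUT hx he' hrow')
    (fun x hx => mul_mul_mem_limUT he' hx heUT hrow)

theorem exists_elementary_fullUT {𝒜 : G → Submodule F (fullUT b).toNonUnitalSubalgebra}
    (h : IsGroupGrading 𝒜) :
    ∃ ℬ : G → Submodule F (fullUT b).toNonUnitalSubalgebra,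
      IsGroupGrading ℬ ∧ IsElementaryGrading b ℬ ∧ GradingIso 𝒜 ℬ := by
  obtain ⟨γ, r, hr⟩ := h.exists_isHomogeneousFrame (limUT_le_fullUT b) le_rfl
  obtain ⟨e, he, he'⟩ := hr.exists_linearEquiv
  have heUT : (e : V →ₗ[F] V) ∈ fullUT b := he ▸ hr.frameMap_mem_fullUT
  exact hr.exists_elementary h (limUT_le_fullUT b) le_rfl he
    (fun x hx => (fullUT b).mul_mem ((fullUT b).mul_mem heUT hx) he')
    (fun x hx => (fullUT b).mul_mem ((fullUT b).mul_mem he' hx) heUT)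

end Frames

theorem theorem1 {F V G : Type*} [Field F] [AddCommGroup V] [Module F V] [Group G]
    (b : Module.Basis ℕ F V) :
    (∀ 𝒜 : G → Submodule F (limUT b), IsGroupGrading 𝒜 →
      ∃ ℬ : G → Submodule F (limUT b),
        IsGroupGrading ℬ ∧ IsElementaryGrading b ℬ ∧ GradingIso 𝒜 ℬ) ∧
    (∀ 𝒜 : G → Submodule F (fullUT b).toNonUnitalSubalgebra, IsGroupGrading 𝒜 →
      (∃ ℬ : G → Submodule F (fullUT b).toNonUnitalSubalgebra,
        IsGroupGrading ℬ ∧ IsElementaryGrading b ℬ ∧ GradingIso 𝒜 ℬ) ∧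
      (gradingSupport 𝒜).Finite) := by
  exact ⟨fun _ h => exists_elementary_limUT h,
    fun _ h => ⟨exists_elementary_fullUT h, finite_gradingSupport_fullUT h⟩⟩
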